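/- **Setting.** Let $f:\mathbb{R}^n\times\mathbb{R}^m\to\mathbb{R}^n$ be continuous, $X\subset\mathbb{R}^n$ bounded, $U\subset\mathbb{R}^m$ compact, $\mathcal Z\subseteq X\times U$ compact, $\mathcal Z_r\subseteq\operatorname{int}\mathcal Z$ closed, and $\mathcal R=\{(x,u)\in\mathcal Z_r : x=f(x,u)\}$. All norms are Euclidean; for $r=(x_r,u_r)$, $\hat r=(x_{\hat r},u_{\hat r})$ put $|r|_{\hat r}=(\|x_r-x_{\hat r}\|^2+\|u_r-u_{\hat r}\|^2)^{1/2}$, and $\mathcal B_c(\tilde x)=\{x:\|x-\tilde x\|\le c\}$. Let $x_u(k,x)$ be the solution of $x(t+1)=f(x(t),u(t))$ from $x$. For a set $S$, $\mathbb U^K_S(x)$ is the set of $u\in U^K$ with $(x_u(k,x),u(k))\in\mathcal Z$ for $0\le k<K$ and $x_u(K,x)\in X\cap S$. Let $\ell:X\times U\times\mathcal R\to\mathbb{R}_{\ge0}$ be a stage cost that is bounded on $\mathcal Z\times\mathcal R$ (e.g. continuous there), $T:\mathcal R\to\mathbb{R}$ an offset cost with unique minimiser $r_d=(x_d,u_d)\in\mathcal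 R$, $\lambda:\mathbb{N}_0\to\mathbb{R}_{\ge0}$, $\bar\ell(x,r)=\min\{\ell(x,u,r):u\in U,\ (x,u)\in\mathcal Z\}$, and $J^d_K(x,u)=\sum_{k=0}^{K-1}\ell(x_u(k,x),u(k),r_d)$. **Assumptions.** 1. There are $\alpha_{lo},\alpha_{up}\in\mathcal K_\infty$ with $\alpha_{lo}(|r|_{r_d})\le T(r)\le\alpha_{up}(|r|_{r_d})$ for all $r\in\mathcal R$. 2. There are $c_1,c_2>0$ with $c_1\|x-x_r\|^2\le\bar\ell(x,r)\le c_2\|x-x_r\|^2$ for all $(x,u)\in\mathcal Z$, $r\in\mathcal R$. 3. There are $c_3,c_4>0$ with $\ell(x,u,r_1)\le c_3\ell(x,u,r_2)+c_4|r_1|_{r_2}^2$ for all $r_1,r_2\in\mathcal R$, $(x,u)\in\mathcal Z$. 4. With constants $c_5,c_6>0$, $\ell(x,u,r_1)\le\ell(x,u,r_2)+c_5|r_1|_{r_2}^2+c_6|r_1|_{r_2}$ for all $r_1,r_2\in\mathcal R$, $(x,u)\in\mathcal Z$. 5. There are $c_b,c_f>0$, $k_f:X\times\mathcal R\to\mathbb{R}^m$,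 a continuous terminal cost $V^f:X\times\mathcal R\to\mathbb{R}_{\ge0}$ and compact sets $\mathcal X^f(r)\subseteq X$ such that for all $r\in\mathcal R$: $\mathcal B_{c_b}(x_r)\subseteq\mathcal X^f(r)$, and for all $x\in\mathcal X^f(r)$, with $x^+=f(x,k_f(x,r))$: $x^+\in\mathcal X^f(r)$, $V^f(x^+,r)-V^f(x,r)\le-\ell(x,k_f(x,r),r)$, $(x,k_f(x,r))\in\mathcal Z$, $V^f(x,r)\le c_f\bar\ell(x,r)$. 6. $\lambda(N)\ge N$ for all $N$ and $\lambda(0)\ge1$. 7. There are $c_1^r,c_2^r>0$ such that for all $r\in\mathcal R$, $\theta\in[0,1]$ there is $\hat r\in\mathcal R$ with $|\hat r|_r\le c_1^r\theta|r|_{r_d}$ and $T(\hat r)-T(r)\le-c_2^r\theta|r|_{r_d}^2$. **The two schemes.** Let $J^{tc}_N(x,u,r)=\sum_{k=0}^{N-1}\ell(x_u(k,x),u(k),r)+V^f(x_u(N,x),r)$. MPC for tracking solves $$V_N(x)=\min_{r\in\mathcal R,\ u\in\mathbb U^N_{\mathcal X^f(r)}(x)}J^{tc}_N(x,u,r)+\lambda(N)T(r),$$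 with feasible set $\mathcal X_N$, and standard MPC solves $W_N(x)=\min_{u\in\mathbb U^N_{\mathcal X^f(r_d)}(x)}J^{tc}_N(x,u,r_d)$, with feasible set $\mathcal X^{std}_N$. The minima are assumed to be attained at every feasible state. Fix any choice of optimal solutions $(u^*_N,r^*_N)(x)$ and $u^*_{std}(x)$, let $\mu_N(x)$ and $\nu_N(x)$ be the first elements of $u^*_N(x)$ and of $u^*_{std}(x)$, and let $x_{\mu_N}(k,x)$, $x_{\nu_N}(k,x)$ be the closed-loop solutions. A function is in $\mathcal L$ if it is continuous and strictly decreasing on $[0,\infty)$ with limit $0$. **Theorem.** Under these assumptions, for every $\widetilde N\in\mathbb{N}_0$ there exist $\delta_1,\delta_2\in\mathcal L$ and $\bar N\ge1$ such that for every $N\ge\bar N$ (and every choice of optimal solutions for the horizon $N$) the following holds. There are $c>0$ and $\gamma\in(0,1)$ with $\|x_{\nu_N}(t,x)-x_d\|\le c\|x-x_d\|\gamma^t$ for all $x\in\mathcal X^{std}_N$, $t\in\mathbb{N}_0$. For every $x\in\mathcal X_{\widetilde N}$ we have $x\in\mathcal X^{std}_N$ and $x_{\mu_N}(k,x)\in\mathcal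 X_N$ for all $k\in\mathbb{N}_0$; and for all $c_{std}>0$, $\gamma_{std}\in(0,1)$ with $\|x_{\nu_N}(t,x)-x_d\|\le c_{std}\|x-x_d\|\gamma_{std}^t$ for all $t\in\mathbb{N}_0$, and all $K\in\mathbb{N}_0$, with $\kappa=c_{std}\|x-x_d\|\gamma_{std}^K$ and $x(k)=x_{\mu_N}(k,x)$, the set $\mathbb U^K_{\mathcal B_\kappa(x_d)}(x)$ is non-empty and $$\sum_{k=0}^{K-1}\ell(x(k),\mu_N(x(k)),r_d)\le\inf_{u\in\mathbb U^K_{\mathcal B_\kappa(x_d)}(x)}J^d_K(x,u)+\delta_1(N)+\delta_2(K)-V_N(x(K))+\sum_{k=0}^{K-1}\Big(c_5|r^*_N(x(k))|_{r_d}^2+c_6|r^*_N(x(k))|_{r_d}\Big).$$ -/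

import Mathlib

open Filter Topology

/-- Class `K_infinity`: continuous, strictly increasing functions on the non-negative reals that
vanish at zero and are unbounded. -/
def IsClassKInf (α : ℝ → ℝ) : Prop :=
  ContinuousOn α (Set.Ici 0) ∧ StrictMonoOn α (Set.Ici 0) ∧ α 0 = 0 ∧ Tendsto α atTop atTop

/-- Class `L`: continuous, strictly decreasing functions on the non-negative reals that tend to
zero (they are automatically positive there). -/
def IsClassL (δ : ℝ → ℝ) : Prop :=
  ContinuousOn δ (Set.Ici 0) ∧ StrictAntiOn δ (Set.Ici 0) ∧ Tendsto δ atTop (𝓝 0)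

/-- Euclidean distance of two state-input pairs (the product carries the sup norm in Mathlib,
hence the explicit formula). -/
noncomputable def refDist {n m : ℕ}
    (r r' : EuclideanSpace ℝ (Fin n) × EuclideanSpace ℝ (Fin m)) : ℝ :=
  Real.sqrt (‖r.1 - r'.1‖ ^ 2 + ‖r.2 - r'.2‖ ^ 2)

/-- The data of an MPC-for-tracking problem. Functions are total; only their values on the domains
named in the comments matter. -/
structure TrackingProblem (n m : ℕ) where
  /-- dynamics -/
  f : EuclideanSpace ℝ (Fin n) → EuclideanSpace ℝ (Fin m) → EuclideanSpace ℝ (Fin n)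
  /-- state space -/
  X : Set (EuclideanSpace ℝ (Fin n))
  /-- input space -/
  U : Set (EuclideanSpace ℝ (Fin m))
  /-- pointwise state and input constraints -/
  Z : Set (EuclideanSpace ℝ (Fin n) × EuclideanSpace ℝ (Fin m))
  /-- constraints for references -/
  Zr : Set (EuclideanSpace ℝ (Fin n) × EuclideanSpace ℝ (Fin m))
  /-- stage cost on `X × U × R` -/
  ℓ : EuclideanSpace ℝ (Fin n) → EuclideanSpace ℝ (Fin m) →
    EuclideanSpace ℝ (Fin n) × EuclideanSpace ℝ (Fin m) → ℝ
  /-- offset cost on `R` -/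
  T : EuclideanSpace ℝ (Fin n) × EuclideanSpace ℝ (Fin m) → ℝ
  /-- best reachable reference `(x_d, u_d)` -/
  rd : EuclideanSpace ℝ (Fin n) × EuclideanSpace ℝ (Fin m)
  /-- terminal cost on `X × R` -/
  Vf : EuclideanSpace ℝ (Fin n) →
    EuclideanSpace ℝ (Fin n) × EuclideanSpace ℝ (Fin m) → ℝ
  /-- terminal sets, indexed by `R` -/
  Xf : EuclideanSpace ℝ (Fin n) × EuclideanSpace ℝ (Fin m) → Set (EuclideanSpace ℝ (Fin n))
  /-- scaling of the offset cost with the horizon -/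
  lam : ℕ → ℝ

namespace TrackingProblem

variable {n m : ℕ} (P : TrackingProblem n m)

/-- The set of admissible references: equilibria in `Zr`. -/
def R : Set (EuclideanSpace ℝ (Fin n) × EuclideanSpace ℝ (Fin m)) :=
  {r | r ∈ P.Zr ∧ r.1 = P.f r.1 r.2}

/-- The solution `x_u(k, x)` for an input sequence `u`. -/
def traj (x : EuclideanSpace ℝ (Fin n)) (u : ℕ → EuclideanSpace ℝ (Fin m)) :
    ℕ → EuclideanSpace ℝ (Fin n)
  | 0 => x
  | k + 1 => P.f (traj x u k) (u k)

/-- The closed loop under a state feedback `μ`, started at `x`. -/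
def closedLoop (μ : EuclideanSpace ℝ (Fin n) → EuclideanSpace ℝ (Fin m))
    (x : EuclideanSpace ℝ (Fin n)) : ℕ → EuclideanSpace ℝ (Fin n)
  | 0 => x
  | k + 1 => P.f (closedLoop μ x k) (μ (closedLoop μ x k))

/-- Admissible input sequences of length `K` from `x` that steer the state into `S` at time `K`.
Sequences of length `K` are represented by infinite sequences of which only the entries
`u 0, …, u (K - 1)` are constrained and used. -/
def admissible (S : Set (EuclideanSpace ℝ (Fin n))) (K : ℕ) (x : EuclideanSpace ℝ (Fin n)) :
    Set (ℕ → EuclideanSpace ℝ (Fin m)) :=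
  {u | (∀ k < K, u k ∈ P.U ∧ (P.traj x u k, u k) ∈ P.Z) ∧ P.traj x u K ∈ P.X ∧ P.traj x u K ∈ S}

/-- `J_K^d(x, u)`: the `K`-step cost with respect to the best reachable reference. -/
noncomputable def Jd (K : ℕ) (x : EuclideanSpace ℝ (Fin n))
    (u : ℕ → EuclideanSpace ℝ (Fin m)) : ℝ :=
  ∑ k ∈ Finset.range K, P.ℓ (P.traj x u k) (u k) P.rd

/-- `J_N^tc(x, u, r)`: the tracking part of the objective. -/
noncomputable def Jtc (N : ℕ) (x : EuclideanSpace ℝ (Fin n))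
    (u : ℕ → EuclideanSpace ℝ (Fin m))
    (r : EuclideanSpace ℝ (Fin n) × EuclideanSpace ℝ (Fin m)) : ℝ :=
  (∑ k ∈ Finset.range N, P.ℓ (P.traj x u k) (u k) r) + P.Vf (P.traj x u N) r

/-- `min_u ℓ(x, u, r)` over the inputs that satisfy the constraints at `x`. -/
noncomputable def lbar (x : EuclideanSpace ℝ (Fin n))
    (r : EuclideanSpace ℝ (Fin n) × EuclideanSpace ℝ (Fin m)) : ℝ :=
  sInf ((fun u => P.ℓ x u r) '' {u | u ∈ P.U ∧ (x, u) ∈ P.Z})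

/-- States at which the MPC-for-tracking problem with horizon `N` is feasible. -/
def feasible (N : ℕ) : Set (EuclideanSpace ℝ (Fin n)) :=
  {x | ∃ r ∈ P.R, (P.admissible (P.Xf r) N x).Nonempty}

/-- The value function `V_N` of MPC for tracking (meaningful on `feasible N`). -/
noncomputable def V (N : ℕ) (x : EuclideanSpace ℝ (Fin n)) : ℝ :=
  sInf {J | ∃ r ∈ P.R, ∃ u ∈ P.admissible (P.Xf r) N x, J = P.Jtc N x u r + P.lam N * P.T r}

/-- `(uStar x, rStar x)` is an optimal solution of the MPC-for-tracking problem with horizon `N`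
at every feasible state `x`. -/
def IsTrackingSolution (N : ℕ)
    (uStar : EuclideanSpace ℝ (Fin n) → ℕ → EuclideanSpace ℝ (Fin m))
    (rStar : EuclideanSpace ℝ (Fin n) →
      EuclideanSpace ℝ (Fin n) × EuclideanSpace ℝ (Fin m)) : Prop :=
  ∀ x ∈ P.feasible N,
    rStar x ∈ P.R ∧ uStar x ∈ P.admissible (P.Xf (rStar x)) N x ∧
    ∀ r ∈ P.R, ∀ u ∈ P.admissible (P.Xf r) N x,
      P.Jtc N x (uStar x) (rStar x) + P.lam N * P.T (rStar x) ≤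
        P.Jtc N x u r + P.lam N * P.T r

/-- States at which the standard MPC problem (fixed reference `rd`) is feasible. -/
def feasibleStd (N : ℕ) : Set (EuclideanSpace ℝ (Fin n)) :=
  {x | (P.admissible (P.Xf P.rd) N x).Nonempty}

/-- `uStd x` is an optimal solution of the standard MPC problem with horizon `N` at every state
`x` at which it is feasible. -/
def IsStandardSolution (N : ℕ)
    (uStd : EuclideanSpace ℝ (Fin n) → ℕ → EuclideanSpace ℝ (Fin m)) : Prop :=
  ∀ x ∈ P.feasibleStd N,
    uStd x ∈ P.admissible (P.Xf P.rd) N x ∧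
    ∀ u ∈ P.admissible (P.Xf P.rd) N x, P.Jtc N x (uStd x) P.rd ≤ P.Jtc N x u P.rd

/-- The standard MPC closed loop started at `x` obeys the exponential estimate with constants
`c > 0` and `γ ∈ (0, 1)`. -/
def StdExpBound (uStd : EuclideanSpace ℝ (Fin n) → ℕ → EuclideanSpace ℝ (Fin m))
    (c γ : ℝ) (x : EuclideanSpace ℝ (Fin n)) : Prop :=
  0 < c ∧ 0 < γ ∧ γ < 1 ∧
    ∀ t : ℕ, ‖P.closedLoop (fun y => uStd y 0) x t - P.rd.1‖ ≤ c * ‖x - P.rd.1‖ * γ ^ t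

/-- Standing assumptions on the problem data. -/
structure Standing : Prop where
  f_cont : Continuous (fun p : EuclideanSpace ℝ (Fin n) × EuclideanSpace ℝ (Fin m) => P.f p.1 p.2)
  X_bdd : Bornology.IsBounded P.X
  U_compact : IsCompact P.U
  Z_compact : IsCompact P.Z
  Z_sub : P.Z ⊆ P.X ×ˢ P.U
  Zr_closed : IsClosed P.Zr
  Zr_sub : P.Zr ⊆ interior P.Z
  ℓ_nonneg : ∀ x ∈ P.X, ∀ u ∈ P.U, ∀ r ∈ P.R, 0 ≤ P.ℓ x u r
  ℓ_bdd : ∃ M : ℝ, ∀ p ∈ P.Z, ∀ r ∈ P.R, P.ℓ p.1 p.2 r ≤ M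
  rd_mem : P.rd ∈ P.R
  rd_unique_min : ∀ r ∈ P.R, r ≠ P.rd → P.T P.rd < P.T r

/-- The offset cost indicates the distance to the best reachable reference. -/
def OffsetCostIndication : Prop :=
  ∃ αlo αup : ℝ → ℝ, IsClassKInf αlo ∧ IsClassKInf αup ∧
    ∀ r ∈ P.R, αlo (refDist r P.rd) ≤ P.T r ∧ P.T r ≤ αup (refDist r P.rd)

/-- Quadratic lower and upper bounds on the minimal stage cost. -/
def StageCostBounds : Prop :=
  ∃ c₁ c₂ : ℝ, 0 < c₁ ∧ 0 < c₂ ∧ ∀ p ∈ P.Z, ∀ r ∈ P.R,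
    c₁ * ‖p.1 - r.1‖ ^ 2 ≤ P.lbar p.1 r ∧ P.lbar p.1 r ≤ c₂ * ‖p.1 - r.1‖ ^ 2

/-- Comparison of stage costs with different references. -/
def StageCostDifference : Prop :=
  ∃ c₃ c₄ : ℝ, 0 < c₃ ∧ 0 < c₄ ∧ ∀ r₁ ∈ P.R, ∀ r₂ ∈ P.R, ∀ p ∈ P.Z,
    P.ℓ p.1 p.2 r₁ ≤ c₃ * P.ℓ p.1 p.2 r₂ + c₄ * refDist r₁ r₂ ^ 2

/-- Comparison of stage costs with different references, with a linear term. -/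
def StageCostDifferenceLinear (c₅ c₆ : ℝ) : Prop :=
  0 < c₅ ∧ 0 < c₆ ∧ ∀ r₁ ∈ P.R, ∀ r₂ ∈ P.R, ∀ p ∈ P.Z,
    P.ℓ p.1 p.2 r₁ ≤ P.ℓ p.1 p.2 r₂ + c₅ * refDist r₁ r₂ ^ 2 + c₆ * refDist r₁ r₂

/-- Terminal ingredients. -/
def TerminalIngredients : Prop :=
  (∀ x ∈ P.X, ∀ r ∈ P.R, 0 ≤ P.Vf x r) ∧
  ContinuousOn (fun p : EuclideanSpace ℝ (Fin n) ×
      (EuclideanSpace ℝ (Fin n) × EuclideanSpace ℝ (Fin m)) => P.Vf p.1 p.2) (P.X ×ˢ P.R) ∧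
  (∀ r ∈ P.R, IsCompact (P.Xf r) ∧ P.Xf r ⊆ P.X) ∧
  ∃ cb cf : ℝ, 0 < cb ∧ 0 < cf ∧
  ∃ kf : EuclideanSpace ℝ (Fin n) → EuclideanSpace ℝ (Fin n) × EuclideanSpace ℝ (Fin m) →
      EuclideanSpace ℝ (Fin m),
    ∀ r ∈ P.R, Metric.closedBall r.1 cb ⊆ P.Xf r ∧ ∀ x ∈ P.Xf r,
      P.f x (kf x r) ∈ P.Xf r ∧
      P.Vf (P.f x (kf x r)) r - P.Vf x r ≤ -P.ℓ x (kf x r) r ∧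
      (x, kf x r) ∈ P.Z ∧
      P.Vf x r ≤ cf * P.lbar x r

/-- The scaling of the offset cost grows at least linearly. -/
def Scaling : Prop :=
  (∀ N : ℕ, (N : ℝ) ≤ P.lam N) ∧ 1 ≤ P.lam 0

/-- Existence of a better candidate reference. -/
def BetterCandidate : Prop :=
  ∃ c₁ c₂ : ℝ, 0 < c₁ ∧ 0 < c₂ ∧ ∀ r ∈ P.R, ∀ θ : ℝ, 0 ≤ θ → θ ≤ 1 → ∃ r' ∈ P.R,
    refDist r' r ≤ c₁ * θ * refDist r P.rd ∧
    P.T r' - P.T r ≤ -c₂ * θ * refDist r P.rd ^ 2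

end TrackingProblem

/-!
The two ideas are a dynamic programming telescope and a turnpike estimate.

Prolonging the tail of an optimal input by the terminal controller shows that the optimal value of
either scheme decreases along its closed loop by at least the stage cost (`exists_shift`). For
standard MPC the value lies between two multiples of `‖x - x_d‖²`, which gives exponential
stability (`exists_stdExpBound`). For MPC for tracking, telescoping bounds the sum of
`ℓ (x k) (μ (x k)) (r* (x k))` by `V_N x - V_N (x K)`, and replacing `r*` by `r_d` costs the
`c₅`- and `c₆`-terms. So it remains to show `V_N x ≤ J_K^d(x, u) + C / (N + 1) + C / (K + 1)` for
every input `u` that satisfies the constraints for `K` steps.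

Since `T r_d = 0`, the cost of any input that is admissible for standard MPC bounds `V_N`. If some
such input costs at most `C` and `J_K^d(x, u) ≤ C`, then the quadratic lower bound on the stage cost
forces the trajectory to come within squared distance `C / (c * min K N)` of `x_d` at some time
`k < min K N` (`exists_sq_norm_sub_le`). Following `u` up to time `k` and the terminal controller
afterwards is admissible and costs at most `J_K^d(x, u)` plus a terminal cost of order
`1 / min K N` (`exists_Jtc_le_Jd_add`). The terminal constraint on `u` is not needed for this bound,
so `δ₁` and `δ₂` do not depend on the decay constants of the standard closed loop.

The uniform bound `C`, together with feasibility of standard MPC on `X_Ñ` for long horizons, comes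
from walking along references (`mem_feasibleStd_of_T_le`): from the terminal set of `r` a uniformly
bounded number of steps leads close to `x_r`, hence into the terminal set of a better reference
`r'` near `r`; each such move decreases `T` by a fixed amount, so that `r_d` is reached after
boundedly many of them.
-/

namespace TrackingProblem

variable {n m : ℕ} {P : TrackingProblem n m}
  {x : EuclideanSpace ℝ (Fin n)} {a : EuclideanSpace ℝ (Fin m)}
  {u : ℕ → EuclideanSpace ℝ (Fin m)} {S : Set (EuclideanSpace ℝ (Fin n))}
  {r r' : EuclideanSpace ℝ (Fin n) × EuclideanSpace ℝ (Fin m)}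
  {N N' K : ℕ} {c v M b : ℝ}

/-! ### The distance of references and decaying functions -/

theorem refDist_comm : refDist r r' = refDist r' r := by
  simp only [refDist, norm_sub_rev]

theorem refDist_nonneg : 0 ≤ refDist r r' := Real.sqrt_nonneg _

theorem norm_fst_sub_le_refDist : ‖r.1 - r'.1‖ ≤ refDist r r' :=
  Real.le_sqrt_of_sq_le (le_add_of_nonneg_right (sq_nonneg _))

theorem isClassL_div_add_one {C : ℝ} (hC : 0 < C) : IsClassL fun s => C / (s + 1) := by
  refine ⟨?_, ?_, ?_⟩
  · refine ContinuousOn.div (by fun_prop) (by fun_prop) fun s hs => ?_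
    have : (0 : ℝ) ≤ s := hs
    positivity
  · intro s hs t _ hst
    have : (0 : ℝ) ≤ s := hs
    exact div_lt_div_of_pos_left hC (by positivity) (by linarith)
  · exact tendsto_const_nhds.div_atTop (tendsto_atTop_add_const_right _ _ tendsto_id)

/-! ### Input sequences -/

/-- The input sequence that applies `a` first and then follows `u`. -/
def consInput (a : EuclideanSpace ℝ (Fin m)) (u : ℕ → EuclideanSpace ℝ (Fin m)) :
    ℕ → EuclideanSpace ℝ (Fin m)
  | 0 => a
  | k + 1 => u k

theorem traj_succ_eq (k : ℕ) :
    P.traj x u (k + 1) = P.traj (P.f x (u 0)) (fun j => u (j + 1)) k := by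
  induction k with
  | zero => rfl
  | succ k ih => rw [traj, ih]; rfl

theorem Jtc_succ : P.Jtc (N + 1) x u r =
    P.ℓ x (u 0) r + P.Jtc N (P.f x (u 0)) (fun j => u (j + 1)) r := by
  simp only [Jtc, Finset.sum_range_succ', traj_succ_eq]
  simp only [traj]
  ring

theorem mem_admissible_succ (hU : ∀ p ∈ P.Z, p.2 ∈ P.U) :
    u ∈ P.admissible S (N + 1) x ↔
      (x, u 0) ∈ P.Z ∧ (fun j => u (j + 1)) ∈ P.admissible S N (P.f x (u 0)) := by
  simp only [admissible, Set.mem_ofPred_eq, traj_succ_eq]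
  constructor
  · rintro ⟨h, hK⟩
    refine ⟨(h 0 (by omega)).2, fun k hk => ?_, hK⟩
    have := h (k + 1) (by omega)
    rwa [traj_succ_eq] at this
  · rintro ⟨h0, h, hK⟩
    refine ⟨fun k hk => ?_, hK⟩
    cases k with
    | zero => exact ⟨hU _ h0, h0⟩
    | succ k => rw [traj_succ_eq]; exact h k (by omega)

theorem consInput_mem_admissible (hU : ∀ p ∈ P.Z, p.2 ∈ P.U) (ha : (x, a) ∈ P.Z)
    (hu : u ∈ P.admissible S N (P.f x a)) : consInput a u ∈ P.admissible S (N + 1) x :=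
  (mem_admissible_succ hU).2 ⟨ha, hu⟩

theorem Jtc_consInput : P.Jtc (N + 1) x (consInput a u) r =
    P.ℓ x a r + P.Jtc N (P.f x a) u r := Jtc_succ

/-! ### The optimal value of MPC for tracking -/

theorem V_eq {uStar : EuclideanSpace ℝ (Fin n) → ℕ → EuclideanSpace ℝ (Fin m)}
    {rStar : EuclideanSpace ℝ (Fin n) → EuclideanSpace ℝ (Fin n) × EuclideanSpace ℝ (Fin m)}
    (hs : P.IsTrackingSolution N uStar rStar) (hx : x ∈ P.feasible N) :
    P.V N x = P.Jtc N x (uStar x) (rStar x) + P.lam N * P.T (rStar x) := by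
  obtain ⟨hr, hu, hopt⟩ := hs x hx
  refine IsLeast.csInf_eq ⟨⟨_, hr, _, hu, rfl⟩, ?_⟩
  rintro _ ⟨r, hr, u, hu, rfl⟩
  exact hopt r hr u hu

theorem V_le {uStar : EuclideanSpace ℝ (Fin n) → ℕ → EuclideanSpace ℝ (Fin m)}
    {rStar : EuclideanSpace ℝ (Fin n) → EuclideanSpace ℝ (Fin n) × EuclideanSpace ℝ (Fin m)}
    (hs : P.IsTrackingSolution N uStar rStar) (hr : r ∈ P.R)
    (hu : u ∈ P.admissible (P.Xf r) N x) :
    P.V N x ≤ P.Jtc N x u r + P.lam N * P.T r := by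
  have hx : x ∈ P.feasible N := ⟨r, hr, u, hu⟩
  rw [V_eq hs hx]
  exact (hs x hx).2.2 r hr u hu

theorem OffsetCostIndication.T_rd (h1 : P.OffsetCostIndication) (hrd : P.rd ∈ P.R) :
    P.T P.rd = 0 := by
  obtain ⟨αlo, αup, hlo, hup, hT⟩ := h1
  have h0 : refDist P.rd P.rd = 0 := by simp [refDist]
  have := hT _ hrd
  rw [h0, hlo.2.2.1, hup.2.2.1] at this
  exact le_antisymm this.2 this.1

/-! ### Quantitative consequences of the assumptions -/

/-- The quantitative content of the assumptions on stage and terminal cost: the stage cost lies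
between `c * ‖x - x_r‖ ^ 2` and `M`, the terminal cost between `0` and both `v * ‖x - x_r‖ ^ 2` and
`M`, the closed ball of radius `b` around `x_r` lies in the terminal set of `r`, and on this set some
input keeps the state inside and lets the terminal cost decrease by the stage cost. -/
structure Estimates (P : TrackingProblem n m) (c v M b : ℝ) : Prop where
  c_pos : 0 < c
  v_pos : 0 < v
  M_pos : 0 < M
  b_pos : 0 < b
  state_mem : ∀ p ∈ P.Z, p.1 ∈ P.X
  input_mem : ∀ p ∈ P.Z, p.2 ∈ P.U
  le_cost : ∀ p ∈ P.Z, ∀ r ∈ P.R, c * ‖p.1 - r.1‖ ^ 2 ≤ P.ℓ p.1 p.2 r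
  cost_le : ∀ p ∈ P.Z, ∀ r ∈ P.R, P.ℓ p.1 p.2 r ≤ M
  terminal_sub : ∀ r ∈ P.R, P.Xf r ⊆ P.X
  ball_sub : ∀ r ∈ P.R, Metric.closedBall r.1 b ⊆ P.Xf r
  terminal_nonneg : ∀ r ∈ P.R, ∀ x ∈ P.X, 0 ≤ P.Vf x r
  terminal_le_sq : ∀ r ∈ P.R, ∀ x ∈ P.Xf r, P.Vf x r ≤ v * ‖x - r.1‖ ^ 2
  terminal_le : ∀ r ∈ P.R, ∀ x ∈ P.Xf r, P.Vf x r ≤ M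
  terminal_step : ∀ r ∈ P.R, ∀ x ∈ P.Xf r, ∃ a, (x, a) ∈ P.Z ∧ P.f x a ∈ P.Xf r ∧
    P.ℓ x a r + P.Vf (P.f x a) r ≤ P.Vf x r

theorem exists_estimates (hP : P.Standing) (h2 : P.StageCostBounds) (h5 : P.TerminalIngredients) :
    ∃ c v M b : ℝ, P.Estimates c v M b := by
  obtain ⟨c₁, c₂, hc₁, hc₂, hl⟩ := h2
  obtain ⟨hV0, -, hXf, cb, cf, hcb, hcf, kf, hk⟩ := h5
  obtain ⟨M₀, hM₀⟩ := hP.ℓ_bdd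
  have hM : M₀ ≤ |M₀| + 1 := (le_abs_self _).trans (by linarith)
  have hM0 : 0 ≤ |M₀| := abs_nonneg _
  have hlbar : ∀ p ∈ P.Z, ∀ r ∈ P.R, P.lbar p.1 r ≤ P.ℓ p.1 p.2 r := by
    intro p hp r hr
    have hpX := hP.Z_sub hp
    refine csInf_le ⟨0, ?_⟩ ⟨p.2, ⟨hpX.2, hp⟩, rfl⟩
    rintro _ ⟨u, hu, rfl⟩
    exact hP.ℓ_nonneg _ hpX.1 _ hu.1 _ hr
  refine ⟨c₁, cf * c₂, (cf + 1) * (|M₀| + 1), cb, hc₁, by positivity, by positivity, hcb,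
    fun p hp => (hP.Z_sub hp).1, fun p hp => (hP.Z_sub hp).2,
    fun p hp r hr => (hl p hp r hr).1.trans (hlbar p hp r hr),
    fun p hp r hr => ?_, fun r hr => (hXf r hr).2, fun r hr => (hk r hr).1,
    fun r hr x hx => hV0 x hx r hr,
    fun r hr x hx => ?_, fun r hr x hx => ?_, fun r hr x hx => ?_⟩
  · have := hM₀ p hp r hr
    nlinarith
  · obtain ⟨-, -, hZ, hle⟩ := (hk r hr).2 x hx
    have := mul_le_mul_of_nonneg_left (hl _ hZ r hr).2 hcf.le
    simp only at this
    linarith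
  · obtain ⟨-, -, hZ, hle⟩ := (hk r hr).2 x hx
    have := mul_le_mul_of_nonneg_left
      (((hlbar _ hZ r hr).trans (hM₀ _ hZ r hr)).trans hM) hcf.le
    simp only at this
    linarith
  · obtain ⟨h1, h2, hZ, -⟩ := (hk r hr).2 x hx
    exact ⟨_, hZ, h1, by linarith⟩

namespace Estimates

theorem cost_nonneg (E : P.Estimates c v M b) {p} (hp : p ∈ P.Z) (hr : r ∈ P.R) :
    0 ≤ P.ℓ p.1 p.2 r :=
  (mul_nonneg E.c_pos.le (sq_nonneg _)).trans (E.le_cost p hp r hr)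

theorem Jtc_nonneg (E : P.Estimates c v M b) (hr : r ∈ P.R) (hu : u ∈ P.admissible S N x) :
    0 ≤ P.Jtc N x u r :=
  add_nonneg (Finset.sum_nonneg fun k hk =>
    E.cost_nonneg (hu.1 k (Finset.mem_range.1 hk)).2 hr) (E.terminal_nonneg r hr _ hu.2.1)

theorem Jtc_le (E : P.Estimates c v M b) (hr : r ∈ P.R) (hu : u ∈ P.admissible (P.Xf r) N x) :
    P.Jtc N x u r ≤ N * M + M := by
  refine add_le_add ?_ (E.terminal_le r hr _ hu.2.2)
  refine (Finset.sum_le_card_nsmul _ _ M fun k hk =>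
    E.cost_le _ (hu.1 k (Finset.mem_range.1 hk)).2 r hr).trans ?_
  simp

theorem sq_norm_sub_le_Jtc (E : P.Estimates c v M b) (hr : r ∈ P.R)
    (hu : u ∈ P.admissible S (N + 1) x) : c * ‖x - r.1‖ ^ 2 ≤ P.Jtc (N + 1) x u r := by
  obtain ⟨hZ, hu'⟩ := (mem_admissible_succ E.input_mem).1 hu
  rw [Jtc_succ]
  have h1 := E.le_cost _ hZ r hr
  have h2 := E.Jtc_nonneg hr hu'
  simp only at h1
  linarith

/-! ### Prolongation by the terminal controller -/

theorem exists_Jtc_succ_le (E : P.Estimates c v M b) (hr : r ∈ P.R)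
    (hu : u ∈ P.admissible (P.Xf r) N x) :
    ∃ u' ∈ P.admissible (P.Xf r) (N + 1) x, P.Jtc (N + 1) x u' r ≤ P.Jtc N x u r := by
  induction N generalizing x u with
  | zero =>
    obtain ⟨a, hZ, hf, hle⟩ := E.terminal_step r hr x hu.2.2
    refine ⟨consInput a u, consInput_mem_admissible E.input_mem hZ
      ⟨fun k hk => absurd hk k.not_lt_zero, E.terminal_sub r hr hf, hf⟩, ?_⟩
    rw [Jtc_consInput]
    simpa [Jtc, traj] using hle
  | succ N ih =>
    obtain ⟨hZ, ht⟩ := (mem_admissible_succ E.input_mem).1 hu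
    obtain ⟨u', hu', hle⟩ := ih ht
    refine ⟨consInput (u 0) u', consInput_mem_admissible E.input_mem hZ hu', ?_⟩
    rw [Jtc_consInput, Jtc_succ (x := x)]
    linarith

theorem exists_Jtc_le_of_le (E : P.Estimates c v M b) (hr : r ∈ P.R) (hN : N ≤ N')
    (hu : u ∈ P.admissible (P.Xf r) N x) :
    ∃ u' ∈ P.admissible (P.Xf r) N' x, P.Jtc N' x u' r ≤ P.Jtc N x u r := by
  induction N', hN using Nat.le_induction with
  | base => exact ⟨u, hu, le_rfl⟩
  | succ N' _ ih =>
    obtain ⟨u', hu', hle⟩ := ih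
    obtain ⟨u'', hu'', hle'⟩ := E.exists_Jtc_succ_le hr hu'
    exact ⟨u'', hu'', hle'.trans hle⟩

theorem exists_Jtc_le_Vf (E : P.Estimates c v M b) (hr : r ∈ P.R) (hx : x ∈ P.Xf r) (N : ℕ) :
    ∃ u ∈ P.admissible (P.Xf r) N x, P.Jtc N x u r ≤ P.Vf x r := by
  obtain ⟨u, hu, hle⟩ := E.exists_Jtc_le_of_le hr (Nat.zero_le N) (x := x) (u := fun _ => 0)
    ⟨fun k hk => absurd hk k.not_lt_zero, E.terminal_sub r hr hx, hx⟩
  exact ⟨u, hu, by simpa [Jtc, traj] using hle⟩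

/-- After applying the first input, the problem with the same reference stays feasible, and the
cost can be decreased by the stage cost just paid. -/
theorem exists_shift (E : P.Estimates c v M b) (hr : r ∈ P.R)
    (hu : u ∈ P.admissible (P.Xf r) (N + 1) x) :
    (x, u 0) ∈ P.Z ∧ ∃ u' ∈ P.admissible (P.Xf r) (N + 1) (P.f x (u 0)),
      P.Jtc (N + 1) (P.f x (u 0)) u' r ≤ P.Jtc (N + 1) x u r - P.ℓ x (u 0) r := by
  obtain ⟨hZ, ht⟩ := (mem_admissible_succ E.input_mem).1 hu
  obtain ⟨u', hu', hle⟩ := E.exists_Jtc_succ_le hr ht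
  refine ⟨hZ, u', hu', ?_⟩
  rw [Jtc_succ (x := x)]
  linarith

/-! ### The turnpike estimate -/

/-- If the accumulated stage cost of `K` steps is at most `C`, then the trajectory is at some time
within squared distance `C / (c * K)` of the reference. -/
theorem exists_sq_norm_sub_le (E : P.Estimates c v M b) (hr : r ∈ P.R) (hK : 0 < K) {C : ℝ}
    (hZ : ∀ k < K, (P.traj x u k, u k) ∈ P.Z)
    (hC : ∑ k ∈ Finset.range K, P.ℓ (P.traj x u k) (u k) r ≤ C) :
    ∃ k < K, ‖P.traj x u k - r.1‖ ^ 2 ≤ C / (c * K) := by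
  have hK' : (0 : ℝ) < K := by exact_mod_cast hK
  have hc := E.c_pos
  obtain ⟨k, hk, hle⟩ := Finset.exists_le_of_sum_le (s := Finset.range K)
    (f := fun k => P.ℓ (P.traj x u k) (u k) r) (g := fun _ => C / K)
    ⟨0, Finset.mem_range.2 hK⟩ (by
      rw [Finset.sum_const, Finset.card_range, nsmul_eq_mul, mul_div_cancel₀ _ hK'.ne']
      exact hC)
  refine ⟨k, Finset.mem_range.1 hk, ?_⟩
  have h := E.le_cost _ (hZ k (Finset.mem_range.1 hk)) r hr
  rw [le_div_iff₀ hK'] at hle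
  rw [le_div_iff₀ (by positivity)]
  calc ‖P.traj x u k - r.1‖ ^ 2 * (c * K) = c * ‖P.traj x u k - r.1‖ ^ 2 * K := by ring
    _ ≤ P.ℓ (P.traj x u k) (u k) r * K := mul_le_mul_of_nonneg_right h hK'.le
    _ ≤ C := hle

/-- If standard MPC can be solved with cost at most `C`, then its optimal cost exceeds the `K`-step
cost of an arbitrary input that satisfies the constraints only by terms of order `1 / N` and
`1 / K`. -/
theorem exists_Jtc_le_Jd_add (E : P.Estimates c v M b) (hrd : P.rd ∈ P.R) {C : ℝ} (hC : 0 < C)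
    (hfeas : ∃ u₀ ∈ P.admissible (P.Xf P.rd) N x, P.Jtc N x u₀ P.rd ≤ C)
    (hZ : ∀ k < K, (P.traj x u k, u k) ∈ P.Z) :
    ∃ u' ∈ P.admissible (P.Xf P.rd) N x, P.Jtc N x u' P.rd ≤ P.Jd K x u +
      2 * (v * (C / c) + C * (C / (c * b ^ 2)) + C) / (N + 1) +
      2 * (v * (C / c) + C * (C / (c * b ^ 2)) + C) / (K + 1) := by
  have hc := E.c_pos
  have hb := E.b_pos
  have hv := E.v_pos
  set A := v * (C / c) + C * (C / (c * b ^ 2)) + C with hA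
  have h1 : 0 < v * (C / c) := by positivity
  have h2 : 0 < C * (C / (c * b ^ 2)) := by positivity
  have hA0 : 0 < A := by positivity
  have hJd : 0 ≤ P.Jd K x u := Finset.sum_nonneg fun k hk =>
    E.cost_nonneg (hZ k (Finset.mem_range.1 hk)) hrd
  set k₀ := min N K with hk₀
  have herr : 2 * A / ((k₀ : ℝ) + 1) ≤ 2 * A / (N + 1) + 2 * A / (K + 1) := by
    have hN : 0 ≤ 2 * A / ((N : ℝ) + 1) := by positivity
    have hK : 0 ≤ 2 * A / ((K : ℝ) + 1) := by positivity
    rcases min_choice N K with h | h <;> rw [hk₀, h] <;> linarith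
  suffices ∃ u' ∈ P.admissible (P.Xf P.rd) N x,
      P.Jtc N x u' P.rd ≤ P.Jd K x u + 2 * A / ((k₀ : ℝ) + 1) by
    obtain ⟨u', hu', hle⟩ := this
    exact ⟨u', hu', by linarith⟩
  by_cases hJC : C ≤ P.Jd K x u
  · obtain ⟨u₀, hu₀, hle⟩ := hfeas
    have : 0 ≤ 2 * A / ((k₀ : ℝ) + 1) := by positivity
    exact ⟨u₀, hu₀, by linarith⟩
  rcases Nat.eq_zero_or_pos k₀ with h0 | h0
  · obtain ⟨u₀, hu₀, hle⟩ := hfeas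
    refine ⟨u₀, hu₀, ?_⟩
    rw [h0, Nat.cast_zero, zero_add, div_one]
    linarith
  have h0' : (1 : ℝ) ≤ k₀ := by exact_mod_cast h0
  have hAk : A / k₀ ≤ 2 * A / ((k₀ : ℝ) + 1) := by
    rw [div_le_div_iff₀ (by positivity) (by positivity)]
    nlinarith
  have hk₀K : k₀ ≤ K := min_le_right _ _
  have hmono : ∀ k ≤ K, ∑ j ∈ Finset.range k, P.ℓ (P.traj x u j) (u j) P.rd ≤ P.Jd K x u :=
    fun k hk => Finset.sum_le_sum_of_subset_of_nonneg (Finset.range_subset_range.2 hk)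
      fun j hj _ => E.cost_nonneg (hZ j (Finset.mem_range.1 hj)) hrd
  by_cases hsmall : C / (c * k₀) ≤ b ^ 2
  · obtain ⟨k, hk, hle⟩ := E.exists_sq_norm_sub_le hrd h0 (fun k hk => hZ k (by omega))
      ((hmono k₀ hk₀K).trans (not_le.1 hJC).le)
    have hXf : P.traj x u k ∈ P.Xf P.rd := E.ball_sub _ hrd (by
      rw [mem_closedBall_iff_norm]
      exact (pow_le_pow_iff_left₀ (norm_nonneg _) hb.le two_ne_zero).1 (hle.trans hsmall))
    have hkN : k ≤ N := hk.le.trans (min_le_left _ _)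
    obtain ⟨u', hu', hle'⟩ := E.exists_Jtc_le_of_le hrd hkN (x := x) (u := u)
      ⟨fun j hj => ⟨E.input_mem _ (hZ j (by omega)), hZ j (by omega)⟩,
        E.terminal_sub _ hrd hXf, hXf⟩
    refine ⟨u', hu', hle'.trans (add_le_add (hmono k (by omega)) (le_trans ?_ hAk))⟩
    calc P.Vf (P.traj x u k) P.rd ≤ v * (C / (c * k₀)) :=
          (E.terminal_le_sq _ hrd _ hXf).trans (mul_le_mul_of_nonneg_left hle hv.le)
      _ = v * (C / c) / k₀ := by field_simp
      _ ≤ A / k₀ := by gcongr; linarith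
  · -- Here `k₀` is bounded in terms of the other constants, so that `A / k₀` exceeds `C`.
    obtain ⟨u₀, hu₀, hle⟩ := hfeas
    refine ⟨u₀, hu₀, ?_⟩
    have : C ≤ A / k₀ := by
      rw [not_le, lt_div_iff₀ (by positivity)] at hsmall
      have h3 : (k₀ : ℝ) ≤ C / (c * b ^ 2) := by
        rw [le_div_iff₀ (by positivity)]
        linarith
      rw [le_div_iff₀ (by positivity)]
      have := mul_le_mul_of_nonneg_left h3 hC.le
      linarith
    linarith

/-! ### Feasibility of standard MPC -/

theorem feasibleStd_mono (E : P.Estimates c v M b) (hrd : P.rd ∈ P.R) (hN : N ≤ N') :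
    P.feasibleStd N ⊆ P.feasibleStd N' := by
  rintro x ⟨u, hu⟩
  obtain ⟨u', hu', -⟩ := E.exists_Jtc_le_of_le hrd hN hu
  exact ⟨u', hu'⟩

theorem mem_feasibleStd_add (E : P.Estimates c v M b)
    (hZ : ∀ k < K, (P.traj x u k, u k) ∈ P.Z) (h : P.traj x u K ∈ P.feasibleStd N) :
    x ∈ P.feasibleStd (N + K) := by
  induction K generalizing x u with
  | zero => exact h
  | succ K ih =>
    obtain ⟨w, hw⟩ := ih (x := P.f x (u 0)) (u := fun j => u (j + 1))
      (fun k hk => by rw [← traj_succ_eq]; exact hZ (k + 1) (by omega))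
      (by rw [← traj_succ_eq]; exact h)
    exact ⟨consInput (u 0) w, consInput_mem_admissible E.input_mem (hZ 0 (by omega)) hw⟩

/-- From the terminal set of `r`, the state can be brought close to `x_r` in fewer than `K` steps. -/
theorem exists_norm_sub_le_half (E : P.Estimates c v M b) (hK : 0 < K)
    (hKb : M / (c * K) ≤ (b / 2) ^ 2) (hr : r ∈ P.R) (hx : x ∈ P.Xf r) :
    ∃ u, ∃ k < K, (∀ j < k, (P.traj x u j, u j) ∈ P.Z) ∧ ‖P.traj x u k - r.1‖ ≤ b / 2 := by
  obtain ⟨u, hu, hle⟩ := E.exists_Jtc_le_Vf hr hx K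
  have hV := E.terminal_nonneg r hr _ hu.2.1
  have hM := E.terminal_le r hr _ hx
  obtain ⟨k, hk, hk'⟩ := E.exists_sq_norm_sub_le hr hK (C := M) (fun k hk => (hu.1 k hk).2)
    (by unfold Jtc at hle; linarith)
  have hb := E.b_pos
  exact ⟨u, k, hk, fun j hj => (hu.1 j (by omega)).2,
    (pow_le_pow_iff_left₀ (norm_nonneg _) (by positivity) two_ne_zero).1 (hk'.trans hKb)⟩

theorem mem_terminal_of_norm_sub_le (E : P.Estimates c v M b) (hr' : r' ∈ P.R)
    (hx : ‖x - r.1‖ ≤ b / 2) (h : refDist r' r ≤ b / 2) : x ∈ P.Xf r' := by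
  refine E.ball_sub _ hr' (mem_closedBall_iff_norm.2 ?_)
  have h1 := norm_sub_le_norm_sub_add_norm_sub x r.1 r'.1
  have h2 := norm_fst_sub_le_refDist (r := r) (r' := r')
  rw [refDist_comm] at h2
  linarith

/-- Walking along references: if every reference far from `r_d` has a nearby reference whose offset
cost is smaller by `η`, then the number of references visited on the way to `r_d` is governed by
the offset cost of the first one. -/
theorem mem_feasibleStd_of_T_le (E : P.Estimates c v M b) (hrd : P.rd ∈ P.R)
    (hT : ∀ r ∈ P.R, 0 ≤ P.T r) {η : ℝ} (hη : 0 < η) (hK : 0 < K)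
    (hKb : M / (c * K) ≤ (b / 2) ^ 2)
    (hmove : ∀ r ∈ P.R, b / 2 < refDist r P.rd →
      ∃ r' ∈ P.R, refDist r' r ≤ b / 2 ∧ P.T r' ≤ P.T r - η)
    (L : ℕ) (hr : r ∈ P.R) (hTr : P.T r ≤ L * η) (hx : x ∈ P.Xf r) :
    x ∈ P.feasibleStd (K * (L + 1)) := by
  induction L generalizing r x with
  | zero =>
    obtain ⟨u, k, hk, hZ, hnear⟩ := E.exists_norm_sub_le_half hK hKb hr hx
    rcases le_or_gt (refDist r P.rd) (b / 2) with h | h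
    · rw [refDist_comm] at h
      obtain ⟨w, hw, -⟩ :=
        E.exists_Jtc_le_Vf hrd (E.mem_terminal_of_norm_sub_le hrd hnear h) 0
      exact E.feasibleStd_mono hrd (by omega) (E.mem_feasibleStd_add hZ ⟨w, hw⟩)
    · obtain ⟨r', hr', -, hT'⟩ := hmove r hr h
      have := hT r' hr'
      rw [Nat.cast_zero, zero_mul] at hTr
      linarith
  | succ L ih =>
    obtain ⟨u, k, hk, hZ, hnear⟩ := E.exists_norm_sub_le_half hK hKb hr hx
    have hKL : K * (L + 1 + 1) = K * (L + 1) + K := by ring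
    rcases le_or_gt (refDist r P.rd) (b / 2) with h | h
    · rw [refDist_comm] at h
      obtain ⟨w, hw, -⟩ :=
        E.exists_Jtc_le_Vf hrd (E.mem_terminal_of_norm_sub_le hrd hnear h) 0
      exact E.feasibleStd_mono hrd (by omega) (E.mem_feasibleStd_add hZ ⟨w, hw⟩)
    · obtain ⟨r', hr', hd, hT'⟩ := hmove r hr h
      rw [Nat.cast_succ, add_one_mul] at hTr
      have := ih hr' (by linarith) (E.mem_terminal_of_norm_sub_le hr' hnear hd)
      exact E.feasibleStd_mono hrd (by omega) (E.mem_feasibleStd_add hZ this)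

/-- Since references and offset costs are bounded, the walk along references takes a uniformly
bounded number of steps from every terminal set. -/
theorem exists_terminal_subset_feasibleStd (E : P.Estimates c v M b) (hP : P.Standing)
    (h1 : P.OffsetCostIndication) (h7 : P.BetterCandidate) :
    ∃ N₀, ∀ r ∈ P.R, P.Xf r ⊆ P.feasibleStd N₀ := by
  obtain ⟨αlo, αup, hlo, hup, hT⟩ := h1
  obtain ⟨d₁, d₂, hd₁, hd₂, hcand⟩ := h7
  have hc := E.c_pos
  have hb := E.b_pos
  have hM := E.M_pos
  have hT0 : ∀ r ∈ P.R, 0 ≤ P.T r := fun r hr => by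
    rw [← hlo.2.2.1]
    exact (hlo.2.1.monotoneOn Set.self_mem_Ici refDist_nonneg refDist_nonneg).trans (hT r hr).1
  obtain ⟨D, hD⟩ : ∃ D : ℝ, ∀ r ∈ P.R, refDist r P.rd ≤ D := by
    obtain ⟨D, hD⟩ := hP.Z_compact.exists_bound_of_continuousOn
      (f := fun r => refDist r P.rd) (by unfold refDist; fun_prop)
    exact ⟨D, fun r hr => (le_abs_self _).trans (hD r (interior_subset (hP.Zr_sub hr.1)))⟩
  have hD0 : 0 ≤ D := refDist_nonneg.trans (hD _ hP.rd_mem)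
  -- A step of relative size `θ` moves the reference by at most `d₁ * θ * D ≤ b / 2`.
  set θ := min 1 (b / 2 / (d₁ * (D + 1))) with hθ
  have hθ0 : 0 < θ := lt_min one_pos (by positivity)
  have hθD : d₁ * θ * D ≤ b / 2 := by
    have : θ ≤ b / 2 / (d₁ * (D + 1)) := min_le_right _ _
    rw [le_div_iff₀ (by positivity)] at this
    nlinarith [mul_pos hd₁ hθ0]
  set η := d₂ * θ * (b / 2) ^ 2 with hη
  have hη0 : 0 < η := by positivity
  have hmove : ∀ r ∈ P.R, b / 2 < refDist r P.rd →
      ∃ r' ∈ P.R, refDist r' r ≤ b / 2 ∧ P.T r' ≤ P.T r - η := by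
    intro r hr hfar
    obtain ⟨r', hr', hd, hdec⟩ := hcand r hr θ hθ0.le (min_le_left _ _)
    refine ⟨r', hr', hd.trans (le_trans ?_ hθD), ?_⟩
    · exact mul_le_mul_of_nonneg_left (hD r hr) (by positivity)
    · have : η ≤ d₂ * θ * refDist r P.rd ^ 2 := by rw [hη]; gcongr
      linarith
  obtain ⟨K, hK⟩ := exists_nat_ge (M / (c * (b / 2) ^ 2))
  obtain ⟨L, hL⟩ := exists_nat_ge (αup D / η)
  have hK0 : 0 < K := by
    have : (0 : ℝ) < K := lt_of_lt_of_le (by positivity) hK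
    exact_mod_cast this
  have hKb : M / (c * K) ≤ (b / 2) ^ 2 := by
    have : (0 : ℝ) < K := by exact_mod_cast hK0
    rw [div_le_iff₀ (by positivity)] at hK ⊢
    linarith
  rw [div_le_iff₀ hη0] at hL
  refine ⟨K * (L + 1), fun r hr x hx =>
    E.mem_feasibleStd_of_T_le hP.rd_mem hT0 hη0 hK0 hKb hmove L hr ?_ hx⟩
  exact (hT r hr).2.trans ((hup.2.1.monotoneOn refDist_nonneg hD0 (hD r hr)).trans hL)

/-! ### The closed loop of standard MPC -/

theorem closedLoop_std_mem (E : P.Estimates c v M b) (hrd : P.rd ∈ P.R)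
    {uStd : EuclideanSpace ℝ (Fin n) → ℕ → EuclideanSpace ℝ (Fin m)}
    (hs : P.IsStandardSolution (N + 1) uStd) (hx : x ∈ P.feasibleStd (N + 1)) (t : ℕ) :
    P.closedLoop (fun y => uStd y 0) x t ∈ P.feasibleStd (N + 1) := by
  induction t with
  | zero => exact hx
  | succ t ih =>
    obtain ⟨-, u', hu', -⟩ := E.exists_shift hrd (hs _ ih).1
    exact ⟨u', hu'⟩

theorem exists_stdExpBound (E : P.Estimates c v M b) (hrd : P.rd ∈ P.R)
    {uStd : EuclideanSpace ℝ (Fin n) → ℕ → EuclideanSpace ℝ (Fin m)}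
    (hs : P.IsStandardSolution (N + 1) uStd) :
    ∃ C γ : ℝ, ∀ x ∈ P.feasibleStd (N + 1), P.StdExpBound uStd C γ x := by
  have hc := E.c_pos
  have hb := E.b_pos
  have hv := E.v_pos
  have hM := E.M_pos
  set W := fun y => P.Jtc (N + 1) y (uStd y) P.rd with hW
  -- The summand `2 * c` only serves to keep the decay factor `1 - c / w` away from `0`.
  set w := v + 2 * c + ((N + 1 : ℕ) * M + M) / b ^ 2 with hw
  have hw1 : 0 < ((N + 1 : ℕ) * M + M) / b ^ 2 := by positivity
  have hw0 : 0 < w := by positivity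
  set ρ := 1 - c / w with hρ
  have hcw : c / w < 1 := by rw [div_lt_one hw0]; linarith
  have hρ0 : 0 < ρ := by linarith
  have hρ1 : ρ < 1 := sub_lt_self _ (by positivity)
  have hWup : ∀ y ∈ P.feasibleStd (N + 1), W y ≤ w * ‖y - P.rd.1‖ ^ 2 := by
    intro y hy
    obtain ⟨hadm, hopt⟩ := hs y hy
    have hsq := sq_nonneg ‖y - P.rd.1‖
    rcases le_or_gt ‖y - P.rd.1‖ b with h | h
    · have hyXf := E.ball_sub _ hrd (mem_closedBall_iff_norm.2 h)
      obtain ⟨u, hu, hle⟩ := E.exists_Jtc_le_Vf hrd hyXf (N + 1)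
      refine (hopt u hu).trans (hle.trans ((E.terminal_le_sq _ hrd _ hyXf).trans ?_))
      exact mul_le_mul_of_nonneg_right (by linarith) hsq
    · refine (E.Jtc_le hrd hadm).trans ?_
      calc ((N + 1 : ℕ) * M + M) = ((N + 1 : ℕ) * M + M) / b ^ 2 * b ^ 2 := by field_simp
        _ ≤ w * ‖y - P.rd.1‖ ^ 2 := by gcongr; linarith
  have hdec : ∀ t, ∀ x ∈ P.feasibleStd (N + 1),
      W (P.closedLoop (fun y => uStd y 0) x t) ≤ ρ ^ t * W x := by
    intro t x hx
    induction t with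
    | zero => simp [closedLoop]
    | succ t ih =>
      set y := P.closedLoop (fun y => uStd y 0) x t with hy
      have hyf : y ∈ P.feasibleStd (N + 1) := E.closedLoop_std_mem hrd hs hx t
      obtain ⟨hZ, u', hu', hle⟩ := E.exists_shift hrd (hs y hyf).1
      have h1 := (hs (P.f y (uStd y 0)) ⟨u', hu'⟩).2 u' hu'
      have h2 := E.le_cost _ hZ _ hrd
      have h3 : c / w * W y ≤ c * ‖y - P.rd.1‖ ^ 2 := by
        rw [div_mul_eq_mul_div, div_le_iff₀ hw0]
        have := mul_le_mul_of_nonneg_left (hWup y hyf) hc.le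
        linarith
      calc W (P.f y (uStd y 0)) ≤ W y - P.ℓ y (uStd y 0) P.rd := h1.trans hle
        _ ≤ ρ * W y := by simp only at h2; rw [hρ]; linarith
        _ ≤ ρ * (ρ ^ t * W x) := mul_le_mul_of_nonneg_left ih hρ0.le
        _ = ρ ^ (t + 1) * W x := by ring
  refine ⟨√(w / c), √ρ, fun x hx => ⟨by positivity, Real.sqrt_pos.2 hρ0, ?_, fun t => ?_⟩⟩
  · rw [Real.sqrt_lt' one_pos]; linarith
  refine (pow_le_pow_iff_left₀ (norm_nonneg _) (by positivity) two_ne_zero).1 ?_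
  have h1 := E.sq_norm_sub_le_Jtc hrd (hs _ (E.closedLoop_std_mem hrd hs hx t)).1
  have h2 := h1.trans (hdec t x hx)
  have h3 : ρ ^ t * W x ≤ ρ ^ t * (w * ‖x - P.rd.1‖ ^ 2) :=
    mul_le_mul_of_nonneg_left (hWup x hx) (by positivity)
  rw [mul_pow, mul_pow, Real.sq_sqrt (by positivity), ← pow_mul, mul_comm t 2, pow_mul,
    Real.sq_sqrt hρ0.le, div_mul_eq_mul_div, div_mul_eq_mul_div, le_div_iff₀ hc]
  linarith

/-- The inputs generated by standard MPC are admissible for the terminal constraint given by its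
exponential estimate. -/
theorem admissible_closedBall_nonempty (E : P.Estimates c v M b) (hrd : P.rd ∈ P.R)
    {uStd : EuclideanSpace ℝ (Fin n) → ℕ → EuclideanSpace ℝ (Fin m)}
    (hs : P.IsStandardSolution (N + 1) uStd) (hx : x ∈ P.feasibleStd (N + 1)) {C γ : ℝ}
    (hbound : P.StdExpBound uStd C γ x) (K : ℕ) :
    (P.admissible (Metric.closedBall P.rd.1 (C * ‖x - P.rd.1‖ * γ ^ K)) K x).Nonempty := by
  set ν := fun y => uStd y 0 with hν
  have htraj : ∀ k, P.traj x (fun j => ν (P.closedLoop ν x j)) k = P.closedLoop ν x k := by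
    intro k
    induction k with
    | zero => rfl
    | succ k ih => rw [traj, ih]; rfl
  have hZ : ∀ k, (P.closedLoop ν x k, ν (P.closedLoop ν x k)) ∈ P.Z := fun k =>
    (E.exists_shift hrd (hs _ (E.closedLoop_std_mem hrd hs hx k)).1).1
  refine ⟨fun j => ν (P.closedLoop ν x j), fun k _ => ?_, ?_, ?_⟩
  · rw [htraj]
    exact ⟨E.input_mem _ (hZ k), hZ k⟩
  · rw [htraj]
    exact E.state_mem _ (hZ K)
  · rw [htraj, mem_closedBall_iff_norm]
    exact hbound.2.2.2 K

/-! ### The closed loop of MPC for tracking -/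

/-- The optimal value of MPC for tracking decreases along the closed loop. -/
theorem tracking_step (E : P.Estimates c v M b)
    {uStar : EuclideanSpace ℝ (Fin n) → ℕ → EuclideanSpace ℝ (Fin m)}
    {rStar : EuclideanSpace ℝ (Fin n) → EuclideanSpace ℝ (Fin n) × EuclideanSpace ℝ (Fin m)}
    (hs : P.IsTrackingSolution (N + 1) uStar rStar) (hx : x ∈ P.feasible (N + 1)) :
    (x, uStar x 0) ∈ P.Z ∧ P.f x (uStar x 0) ∈ P.feasible (N + 1) ∧
      P.ℓ x (uStar x 0) (rStar x) ≤ P.V (N + 1) x - P.V (N + 1) (P.f x (uStar x 0)) := by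
  obtain ⟨hr, hu, -⟩ := hs x hx
  obtain ⟨hZ, u', hu', hle⟩ := E.exists_shift hr hu
  refine ⟨hZ, ⟨_, hr, u', hu'⟩, ?_⟩
  have := V_le hs hr hu'
  rw [V_eq hs hx]
  linarith

theorem closedLoop_tracking_mem (E : P.Estimates c v M b)
    {uStar : EuclideanSpace ℝ (Fin n) → ℕ → EuclideanSpace ℝ (Fin m)}
    {rStar : EuclideanSpace ℝ (Fin n) → EuclideanSpace ℝ (Fin n) × EuclideanSpace ℝ (Fin m)}
    (hs : P.IsTrackingSolution (N + 1) uStar rStar) (hx : x ∈ P.feasible (N + 1)) (k : ℕ) :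
    P.closedLoop (fun y => uStar y 0) x k ∈ P.feasible (N + 1) := by
  induction k with
  | zero => exact hx
  | succ k ih => exact (E.tracking_step hs ih).2.1

/-- Telescoping the decrease of `V_N`; replacing the optimal references by `r_d` in the stage cost is
paid for by the last sum. -/
theorem sum_cost_le (E : P.Estimates c v M b) (hrd : P.rd ∈ P.R) {c₅ c₆ : ℝ}
    (h4 : P.StageCostDifferenceLinear c₅ c₆)
    {uStar : EuclideanSpace ℝ (Fin n) → ℕ → EuclideanSpace ℝ (Fin m)}
    {rStar : EuclideanSpace ℝ (Fin n) → EuclideanSpace ℝ (Fin n) × EuclideanSpace ℝ (Fin m)}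
    (hs : P.IsTrackingSolution (N + 1) uStar rStar) (hx : x ∈ P.feasible (N + 1)) (K : ℕ) :
    ∑ k ∈ Finset.range K,
        P.ℓ (P.closedLoop (fun y => uStar y 0) x k)
          (uStar (P.closedLoop (fun y => uStar y 0) x k) 0) P.rd
      ≤ P.V (N + 1) x - P.V (N + 1) (P.closedLoop (fun y => uStar y 0) x K)
        + ∑ k ∈ Finset.range K,
            (c₅ * refDist (rStar (P.closedLoop (fun y => uStar y 0) x k)) P.rd ^ 2
              + c₆ * refDist (rStar (P.closedLoop (fun y => uStar y 0) x k)) P.rd) := by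
  induction K with
  | zero => simp [closedLoop]
  | succ K ih =>
    have hK := E.closedLoop_tracking_mem hs hx K
    obtain ⟨hZ, -, hdec⟩ := E.tracking_step hs hK
    have h := h4.2.2 _ hrd _ (hs _ hK).1 _ hZ
    rw [refDist_comm] at h
    rw [Finset.sum_range_succ, Finset.sum_range_succ]
    simp only [closedLoop] at h hdec ⊢
    linarith

end Estimates

end TrackingProblem

theorem mainTheorem1 {n m : ℕ} (P : TrackingProblem n m) (c₅ c₆ : ℝ)
    (hP : P.Standing)
    (h1 : P.OffsetCostIndication)
    (h2 : P.StageCostBounds)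
    (h3 : P.StageCostDifference)
    (h4 : P.StageCostDifferenceLinear c₅ c₆)
    (h5 : P.TerminalIngredients)
    (h6 : P.Scaling)
    (h7 : P.BetterCandidate) :
    ∀ Ntilde : ℕ, ∃ δ₁ δ₂ : ℝ → ℝ, IsClassL δ₁ ∧ IsClassL δ₂ ∧ ∃ Nbar : ℕ, 1 ≤ Nbar ∧
      ∀ N : ℕ, Nbar ≤ N →
      ∀ uStd : EuclideanSpace ℝ (Fin n) → ℕ → EuclideanSpace ℝ (Fin m),
      P.IsStandardSolution N uStd →
        (∃ c γ : ℝ, ∀ x ∈ P.feasibleStd N, P.StdExpBound uStd c γ x) ∧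
        ∀ (uStar : EuclideanSpace ℝ (Fin n) → ℕ → EuclideanSpace ℝ (Fin m))
          (rStar : EuclideanSpace ℝ (Fin n) →
            EuclideanSpace ℝ (Fin n) × EuclideanSpace ℝ (Fin m)),
        P.IsTrackingSolution N uStar rStar →
        ∀ x ∈ P.feasible Ntilde, x ∈ P.feasibleStd N ∧
          (∀ k : ℕ, P.closedLoop (fun y => uStar y 0) x k ∈ P.feasible N) ∧
          ∀ cstd γstd : ℝ, P.StdExpBound uStd cstd γstd x → ∀ K : ℕ,
            (P.admissible (Metric.closedBall P.rd.1 (cstd * ‖x - P.rd.1‖ * γstd ^ K))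
              K x).Nonempty ∧
            ∑ k ∈ Finset.range K,
                P.ℓ (P.closedLoop (fun y => uStar y 0) x k)
                  (uStar (P.closedLoop (fun y => uStar y 0) x k) 0) P.rd
              ≤ sInf (P.Jd K x ''
                    P.admissible (Metric.closedBall P.rd.1 (cstd * ‖x - P.rd.1‖ * γstd ^ K)) K x)
                + δ₁ N + δ₂ K
                - P.V N (P.closedLoop (fun y => uStar y 0) x K)
                + ∑ k ∈ Finset.range K,
                    (c₅ * refDist (rStar (P.closedLoop (fun y => uStar y 0) x k)) P.rd ^ 2
                      + c₆ * refDist (rStar (P.closedLoop (fun y => uStar y 0) x k)) P.rd) := by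
  intro Ntilde
  obtain ⟨c, v, M, b, E⟩ := TrackingProblem.exists_estimates hP h2 h5
  have hrd := hP.rd_mem
  obtain ⟨N₀, hN₀⟩ := E.exists_terminal_subset_feasibleStd hP h1 h7
  have hM := E.M_pos
  have hc := E.c_pos
  have hv := E.v_pos
  have hb := E.b_pos
  -- Inputs of length `N₀ + Ntilde` cost at most `C`, and prolonging them does not increase the cost.
  set C := ((N₀ + Ntilde : ℕ) : ℝ) * M + M with hC
  have hC0 : 0 < C := by positivity
  set A := 2 * (v * (C / c) + C * (C / (c * b ^ 2)) + C) with hA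
  have hA0 : 0 < A := by positivity
  refine ⟨fun s => A / (s + 1), fun s => A / (s + 1), TrackingProblem.isClassL_div_add_one hA0,
    TrackingProblem.isClassL_div_add_one hA0, N₀ + Ntilde + 1, by omega, ?_⟩
  intro N' hN' uStd hStd
  obtain ⟨N, rfl⟩ : ∃ N, N' = N + 1 := ⟨N' - 1, by omega⟩
  refine ⟨E.exists_stdExpBound hrd hStd, fun uStar rStar hStar x hx => ?_⟩
  obtain ⟨r, hr, u, hu⟩ := hx
  obtain ⟨w, hw⟩ := E.mem_feasibleStd_add (fun k hk => (hu.1 k hk).2) (hN₀ r hr hu.2.2)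
  obtain ⟨w', hw', hwle⟩ := E.exists_Jtc_le_of_le hrd (by omega : N₀ + Ntilde ≤ N + 1) hw
  have hxStd : x ∈ P.feasibleStd (N + 1) := ⟨w', hw'⟩
  have hxf : x ∈ P.feasible (N + 1) := ⟨_, hrd, w', hw'⟩
  refine ⟨hxStd, E.closedLoop_tracking_mem hStar hxf, fun cstd γstd hbound K => ?_⟩
  have hne := E.admissible_closedBall_nonempty hrd hStd hxStd hbound K
  refine ⟨hne, ?_⟩
  have hV : P.V (N + 1) x - A / (((N + 1 : ℕ) : ℝ) + 1) - A / ((K : ℝ) + 1) ≤ sInf (P.Jd K x ''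
      P.admissible (Metric.closedBall P.rd.1 (cstd * ‖x - P.rd.1‖ * γstd ^ K)) K x) := by
    refine le_csInf (hne.image _) ?_
    rintro _ ⟨u, hu, rfl⟩
    obtain ⟨u', hu', hle⟩ := E.exists_Jtc_le_Jd_add hrd hC0
      ⟨w', hw', hwle.trans (E.Jtc_le hrd hw)⟩ (fun k hk => (hu.1 k hk).2)
    have hVle := TrackingProblem.V_le hStar hrd hu'
    rw [h1.T_rd hrd, mul_zero, add_zero] at hVle
    linarith
  have hsum := E.sum_cost_le hrd h4 hStar hxf K
  simp only
  linarith
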